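/- Let $R$ be a commutative artinian ring and let $A$ be an artin algebra over $R$ (an $R$-algebra that is finitely generated as an $R$-module). Modules are finitely generated left $A$-modules, and $\operatorname{gl.dim} A$ is the supremum of their projective dimensions. Assume that $A$ is connected (nonzero and not a direct sum of two proper two-sided ideals) and Nakayama (all indecomposable projective and all indecomposable injective modules are uniserial, i.e. have a unique composition series), that $A$ has exactly three simple modules up to isomorphism, and that $A$ is a cycle algebra: the simple modules can be ordered $S_1,S_2,S_3$ such that $\operatorname{Ext}^1_A(S_i,S_j)\neq 0$ if and only if $j\equiv i+1 \pmod 3$. Assume that $A$ is not self-injective, i.e. $A$ is not injective as a left $A$-module. For such an ordering let $P_j$ be the projective cover of $S_j$ and $c_j=l(P_j)$ its composition length. A sequence $(c_1,c_2,c_3)$ of positive integers is called admissible if $2\le c_1\le c_2+1$, $2\le c_2\le c_3+1$ and $c_3\le c_1+1$. An admissible sequence is called normalized if $c_3=1$, or $c_1=c_2=c_3$, or $c_1=\min_j c_j$ and $c_3=c_1+1$. Among the sequences $(c_1,c_2,c_3)$ obtained from all such orderings of the simple modules there is exactly one normalized admissible sequence, denoted $\mathbf c(A)$. Then $A$ has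 finite global dimension if and only if $\mathbf c(A)$ is $(2,2,3)$, $(2,4,3)$, $(3,4,4)$ or $(3,5,4)$. In these cases $\operatorname{gl.dim} A$ equals $3$, $2$, $4$ and $2$, respectively. -/

import Mathlib

open CategoryTheory

universe u v

namespace Nakayama

section Modules

variable (A : Type u) [Ring A] (M : Type u) [AddCommGroup M] [Module A M]

/-- A module is uniserial if it has a unique composition series. -/
def IsUniserial : Prop :=
  ∃! s : CompositionSeries (Submodule A M), s.head = ⊥ ∧ s.last = ⊤

/-- A module is indecomposable if it is nonzero and is not the direct sum of two nonzero
submodules. -/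
def IsIndecomposable : Prop :=
  Nontrivial M ∧ ∀ N K : Submodule A M, IsCompl N K → N = ⊥ ∨ K = ⊥

/-- `f : P → M` is a projective cover: `P` is projective, and `f` is surjective with superfluous
kernel. -/
def IsProjectiveCover {A : Type u} [Ring A] {P M : Type u} [AddCommGroup P] [Module A P]
    [AddCommGroup M] [Module A M] (f : P →ₗ[A] M) : Prop :=
  Module.Projective A P ∧ Function.Surjective f ∧
    ∀ N : Submodule A P, N ⊔ LinearMap.ker f = ⊤ → N = ⊤

end Modules

section Rings

variable (A : Type u) [Ring A]

/-- `A` is connected: it is nonzero and is not the direct sum of two proper two-sided ideals. -/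
def IsConnected : Prop :=
  Nontrivial A ∧ ∀ I J : TwoSidedIdeal A, IsCompl I J → I = ⊤ ∨ J = ⊤

/-- The Nakayama condition: all finitely generated indecomposable projective and all finitely
generated indecomposable injective left modules are uniserial. -/
def IsNakayama : Prop :=
  ∀ (M : Type u) [AddCommGroup M] [Module A M], Module.Finite A M → IsIndecomposable A M →
    (Module.Projective A M ∨ Module.Injective A M) → IsUniserial A M

/-- The global dimension: the supremum of the projective dimensions of the finitely generated
left modules. -/
noncomputable def globalDimension : WithBot ℕ∞ :=
  ⨆ (M : ModuleCat.{u} A) (_ : Module.Finite A M), projectiveDimension M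

/-- `S 0, …, S (n-1)` is a complete set of representatives of the isomorphism classes of simple
left `A`-modules, ordered so that the quiver of `A` (with an arrow `S i → S j` exactly when
`Ext¹(S i, S j) ≠ 0`) is the oriented cycle `S 0 → S 1 → ⋯ → S (n-1) → S 0`.
Here `i + 1` is the cyclic successor in `Fin n`. -/
structure IsCyclicOrdering {n : ℕ} [NeZero n] (S : Fin n → ModuleCat.{u} A) : Prop where
  simple : ∀ i, IsSimpleModule A (S i)
  pairwise_nonisomorphic : ∀ i j, Nonempty (S i ≅ S j) → i = j
  complete : ∀ T : ModuleCat.{u} A, IsSimpleModule A T → ∃ i, Nonempty (T ≅ S i)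
  arrow_iff : ∀ i j, Nontrivial (Abelian.Ext.{u} (S i) (S j) 1) ↔ j = i + 1

/-- `A` is a cycle algebra with `n` simple modules: a connected Nakayama algebra whose quiver is
an oriented cycle on `n` vertices. (For Nakayama algebras the valuation of the quiver is
automatically trivial.) -/
def IsCycleAlgebra (n : ℕ) [NeZero n] : Prop :=
  IsConnected A ∧ IsNakayama A ∧ ∃ S : Fin n → ModuleCat.{u} A, IsCyclicOrdering A S

end Rings

/-- Admissible sequences `(c 0, …, c (n-1))` of positive integers. In the last condition
`j + 1` is the cyclic successor in `Fin n`. -/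
def IsAdmissible {n : ℕ} [NeZero n] (c : Fin n → ℕ) : Prop :=
  (∀ j, 1 ≤ c j) ∧ (∀ j : Fin n, (j : ℕ) + 1 < n → 2 ≤ c j) ∧ ∀ j, c j ≤ c (j + 1) + 1

/-- Normalized admissible sequences; `Fin.rev 0` is the last index `n - 1`. -/
def IsNormalized {n : ℕ} [NeZero n] (c : Fin n → ℕ) : Prop :=
  IsAdmissible c ∧
    (c (Fin.rev 0) = 1 ∨ (∀ i j, c i = c j) ∨
      ((∀ j, c 0 ≤ c j) ∧ c (Fin.rev 0) = c 0 + 1))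

/-- `c` is the sequence of lengths of the projective covers of the simple modules of a cycle
algebra `A`, for some cyclic ordering of the simple modules. -/
def IsSequenceOf (A : Type u) [Ring A] {n : ℕ} [NeZero n] (c : Fin n → ℕ) : Prop :=
  ∃ S : Fin n → ModuleCat.{u} A, IsCyclicOrdering A S ∧
    ∀ j, ∃ (P : ModuleCat.{u} A) (f : P →ₗ[A] S j),
      IsProjectiveCover f ∧ Module.length A P = (c j : ℕ∞)

/-- `c` is a normalized admissible sequence of the cycle algebra `A`. -/
def IsNormalizedSequenceOf (A : Type u) [Ring A] {n : ℕ} [NeZero n] (c : Fin n → ℕ) : Prop :=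
  IsNormalized c ∧ IsSequenceOf A c

end Nakayama

/-! Write `(i, l)` for the quotient of length `l` of `P i`. The proof reduces homological algebra to
the dynamics of these pairs.

If the radical of `P i` maps onto a simple `T`, then `Ext¹(S i, T) ≠ 0`, so the cyclic quiver forces
`T ≅ S (i + 1)`. By uniseriality the radical is then an image of `P (i + 1)`
(`exists_range_eq_ker`). Iterating, the submodule of colength `l` in `P i` is an image of `P (i +
l)`. Hence for `0 < l < c i` the pair `(i, l)` is not projective and has syzygy `(i + l, c i - l)`,
while `(i, c i)` is projective (`exists_syzygy`).

Global dimension is therefore infinite as soon as some set of nonprojective pairs is closed under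
syzygy; otherwise it is read off from the orbits of the simples `(i, 1)`. A nonconstant normalized
sequence is `(m, m + e, m + 1)` with `e = 0, 1, 2`. For each `e` and each residue of `m` modulo 3 a
small closed set exists, except in four cases where its member `(i, 3)` has `c i = 3` and so is
projective. These are the four listed sequences. -/

namespace Nakayama

/-! ### Uniserial modules and length -/

section UniserialModules

variable {A : Type u} [Ring A] {M : Type u} [AddCommGroup M] [Module A M]

theorem IsUniserial.le_total [IsNoetherian A M] [IsArtinian A M] (h : IsUniserial A M)
    (N K : Submodule A M) : N ≤ K ∨ K ≤ N := by
  obtain ⟨s, -, hs⟩ := h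
  have mem (N : Submodule A M) : N ∈ s := by
    -- The chain consisting of `N` alone refines to a composition series, which must be `s` by
    -- uniqueness.
    obtain ⟨t, i, hi, ht⟩ := LTSeries.exists_relSeries_covBy_and_head_eq_bot_and_last_eq_bot
      (RelSeries.singleton _ N : LTSeries (Submodule A M))
    rw [← hs t ht]
    exact ⟨i 0, congr_fun hi 0⟩
  exact CompositionSeries.total (mem N) (mem K)

theorem length_ker_add {N : Type u} [AddCommGroup N] [Module A N] (f : M →ₗ[A] N)
    (hf : Function.Surjective f) :
    Module.length A M = Module.length A (LinearMap.ker f) + Module.length A N :=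
  Module.length_eq_add_of_exact (LinearMap.ker f).subtype f (Submodule.subtype_injective _) hf
    (LinearMap.exact_subtype_ker_map f)

theorem length_ker_add_range {N : Type u} [AddCommGroup N] [Module A N] (f : M →ₗ[A] N) :
    Module.length A M = Module.length A (LinearMap.ker f) +
      Module.length A (LinearMap.range f) := by
  have := length_ker_add f.rangeRestrict f.surjective_rangeRestrict
  rwa [LinearMap.ker_rangeRestrict] at this

theorem eq_of_le_of_length_le [IsNoetherian A M] [IsArtinian A M] {N K : Submodule A M}
    (h : N ≤ K) (hl : Module.length A K ≤ Module.length A N) : N = K := by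
  by_contra hne
  rw [Module.length_submodule, Module.length_submodule] at hl
  exact hl.not_gt (Submodule.height_strictMono (lt_of_le_of_ne h hne))

theorem IsUniserial.eq_of_length_eq [IsNoetherian A M] [IsArtinian A M] (h : IsUniserial A M)
    {N K : Submodule A M} (hl : Module.length A N = Module.length A K) : N = K := by
  rcases h.le_total N K with hNK | hKN
  · exact eq_of_le_of_length_le hNK hl.ge
  · exact (eq_of_le_of_length_le hKN hl.le).symm

end UniserialModules

/-! ### Projective covers of simple modules -/

section ProjectiveCovers

variable {A : Type u} [Ring A] {P S : Type u} [AddCommGroup P] [Module A P]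
  [AddCommGroup S] [Module A S] {f : P →ₗ[A] S}

theorem IsProjectiveCover.eq_top_of_map_eq_top (hf : IsProjectiveCover f) {N : Submodule A P}
    (h : N.map f = ⊤) : N = ⊤ := by
  apply hf.2.2
  have := Submodule.comap_map_eq f N
  rw [← this, h, Submodule.comap_top]

theorem IsProjectiveCover.eq_top_or_le_ker [IsSimpleModule A S] (hf : IsProjectiveCover f)
    (N : Submodule A P) : N = ⊤ ∨ N ≤ LinearMap.ker f := by
  rcases eq_bot_or_eq_top (N.map f) with h | h
  · exact Or.inr (LinearMap.le_ker_iff_map.2 h)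
  · exact Or.inl (hf.eq_top_of_map_eq_top h)

theorem IsProjectiveCover.ker_ne_top [IsSimpleModule A S] (hf : IsProjectiveCover f) :
    LinearMap.ker f ≠ ⊤ := by
  intro h
  rw [LinearMap.ker_eq_top] at h
  obtain ⟨x, hx⟩ := @exists_ne _ (IsSimpleModule.nontrivial A S) (0 : S)
  obtain ⟨y, rfl⟩ := hf.2.1 x
  simp [h] at hx

theorem IsProjectiveCover.isIndecomposable [IsSimpleModule A S] (hf : IsProjectiveCover f) :
    IsIndecomposable A P := by
  have := IsSimpleModule.nontrivial A S
  refine ⟨hf.2.1.nontrivial, fun N K hNK => ?_⟩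
  rcases hf.eq_top_or_le_ker N with h | h
  · exact Or.inr (by simpa [h] using hNK.inf_eq_bot)
  · rcases hf.eq_top_or_le_ker K with h' | h'
    · exact Or.inl (by simpa [h'] using hNK.inf_eq_bot)
    · exact absurd (top_le_iff.1 (hNK.sup_eq_top ▸ sup_le h h')) hf.ker_ne_top

theorem IsProjectiveCover.finite [IsSimpleModule A S] (hf : IsProjectiveCover f) :
    Module.Finite A P := by
  obtain ⟨x, hx⟩ : ∃ x, x ∉ LinearMap.ker f := by
    by_contra! h
    exact hf.ker_ne_top (eq_top_iff.2 fun x _ => h x)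
  refine ⟨⟨{x}, ?_⟩⟩
  rcases hf.eq_top_or_le_ker (Submodule.span A (({x} : Finset P) : Set P)) with h | h
  · exact h
  · exact absurd (h (Submodule.subset_span (by simp))) hx

/-- A projective cover is a quotient of every projective module mapping onto the same module. -/
theorem IsProjectiveCover.exists_surjective (hf : IsProjectiveCover f) {Q : Type u}
    [AddCommGroup Q] [Module A Q] [Module.Projective A Q] (q : Q →ₗ[A] S)
    (hq : Function.Surjective q) : ∃ g : Q →ₗ[A] P, f ∘ₗ g = q ∧ Function.Surjective g := by
  obtain ⟨g, hg⟩ := Module.projective_lifting_property f q hf.2.1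
  refine ⟨g, hg, LinearMap.range_eq_top.1 (hf.eq_top_of_map_eq_top ?_)⟩
  rw [← LinearMap.range_comp, hg, LinearMap.range_eq_top.2 hq]

theorem IsProjectiveCover.length_eq (hf : IsProjectiveCover f) {Q : Type u}
    [AddCommGroup Q] [Module A Q] {q : Q →ₗ[A] S} (hq : IsProjectiveCover q) :
    Module.length A P = Module.length A Q := by
  have := hf.1
  have := hq.1
  obtain ⟨g, -, hg⟩ := hf.exists_surjective q hq.2.1
  obtain ⟨g', -, hg'⟩ := hq.exists_surjective f hf.2.1
  exact le_antisymm (Module.length_le_of_surjective g hg)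
    (Module.length_le_of_surjective g' hg')

theorem IsProjectiveCover.comp_equiv (hf : IsProjectiveCover f) {T : Type u} [AddCommGroup T]
    [Module A T] (e : S ≃ₗ[A] T) : IsProjectiveCover (e.toLinearMap ∘ₗ f) := by
  refine ⟨hf.1, e.surjective.comp hf.2.1, ?_⟩
  rw [LinearEquiv.ker_comp]
  exact hf.2.2

/-- A submodule `N` of `A` minimal among those mapping onto `S` works: minimality makes the kernel
superfluous, and `N` splits off `A`, hence is projective. -/
theorem exists_isProjectiveCover [IsArtinianRing A] [IsSimpleModule A S] :
    ∃ (P : ModuleCat.{u} A) (f : P →ₗ[A] S), IsProjectiveCover f := by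
  obtain ⟨x, hx⟩ := @exists_ne _ (IsSimpleModule.nontrivial A S) (0 : S)
  let π : A →ₗ[A] S := LinearMap.toSpanSingleton A S x
  have hπ : Function.Surjective π := IsSimpleModule.toSpanSingleton_surjective A hx
  obtain ⟨N, hN, hmin⟩ := WellFounded.has_min (wellFounded_lt (α := Submodule A A))
    {N | N.map π = ⊤} ⟨⊤, by simpa using LinearMap.range_eq_top.2 hπ⟩
  have hmin' (K : Submodule A A) (hK : K ≤ N) (h : K.map π = ⊤) : K = N := by
    by_contra hne
    exact hmin K h (lt_of_le_of_ne hK hne)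
  let f : N →ₗ[A] S := π ∘ₗ N.subtype
  have hfs : Function.Surjective f := by
    rw [← LinearMap.range_eq_top, LinearMap.range_comp, Submodule.range_subtype]
    exact hN
  have hcov (K : Submodule A N) (h : K.map f = ⊤) : K = ⊤ := by
    have := hmin' (K.map N.subtype) (Submodule.map_subtype_le N K)
      (by rw [← Submodule.map_comp]; exact h)
    apply Submodule.map_injective_of_injective N.subtype_injective
    rw [this, Submodule.map_top, Submodule.range_subtype]
  obtain ⟨φ, hφ⟩ := Module.projective_lifting_property f π hfs
  -- This endomorphism of `N` lies over the identity of `S`, so its image still maps onto `S`. Being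
  -- onto, it is bijective by noetherianity, and its inverse splits `φ`.
  have hs : Function.Surjective (φ ∘ₗ N.subtype) := by
    rw [← LinearMap.range_eq_top]
    apply hcov
    rw [← LinearMap.range_comp, ← LinearMap.comp_assoc, hφ]
    exact LinearMap.range_eq_top.2 hfs
  have hb := IsNoetherian.bijective_of_surjective_endomorphism _ hs
  let e := LinearEquiv.ofBijective _ hb
  have hproj : Module.Projective A N := by
    refine Module.Projective.of_split (N.subtype ∘ₗ e.symm.toLinearMap) φ ?_
    ext y
    exact congr_arg Subtype.val (e.apply_symm_apply y)
  refine ⟨ModuleCat.of A N, f, hproj, hfs, fun K hK => hcov K ?_⟩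
  rw [eq_top_iff, ← LinearMap.range_eq_top.2 hfs, ← Submodule.map_top, ← hK, Submodule.map_sup,
    (LinearMap.le_ker_iff_map (p := LinearMap.ker f)).1 le_rfl, sup_bot_eq]

end ProjectiveCovers

end Nakayama

namespace Nakayama

/-! ### Extensions of simples and the radical of a projective cover -/

section Covers

variable {A : Type u} [Ring A]

theorem IsNakayama.isUniserial (hA : IsNakayama A) {P S : Type u} [AddCommGroup P] [Module A P]
    [AddCommGroup S] [Module A S] [IsSimpleModule A S] {f : P →ₗ[A] S}
    (hf : IsProjectiveCover f) : IsUniserial A P :=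
  hA P hf.finite hf.isIndecomposable (Or.inl hf.1)

/-- If the Ext group vanished, `q` would extend to `P`. A map from `P` to a simple module kills the
unique maximal submodule `ker f`, so `q` would be zero. -/
theorem IsProjectiveCover.nontrivial_ext {P S T : ModuleCat.{u} A} [IsSimpleModule A S]
    [IsSimpleModule A T] {f : P →ₗ[A] S} (hf : IsProjectiveCover f)
    {q : LinearMap.ker f →ₗ[A] T} (hq : q ≠ 0) :
    Nontrivial (Abelian.Ext.{u} S T 1) := by
  by_contra hne
  rw [not_nontrivial_iff_subsingleton] at hne
  have hse : (f.shortComplexKer).ShortExact := LinearMap.shortExact_shortComplexKer hf.2.1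
  obtain ⟨x, hx⟩ := Abelian.Ext.contravariant_sequence_exact₁ hse T
    (Abelian.Ext.mk₀ (ModuleCat.ofHom q)) (n₁ := 1) rfl (Subsingleton.elim (α := Abelian.Ext S T 1) _ _)
  obtain ⟨p, rfl⟩ := (Abelian.Ext.mk₀_bijective _ _).2 x
  rw [Abelian.Ext.mk₀_comp_mk₀] at hx
  have hx := (Abelian.Ext.mk₀_bijective _ _).1 hx
  have hp : ∀ y : LinearMap.ker f, p.hom (y : P) = q y := fun y =>
    congr_arg (fun r => r.hom y) hx
  have hker : LinearMap.ker f ≤ LinearMap.ker p.hom := by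
    rcases hf.eq_top_or_le_ker (LinearMap.ker p.hom) with h | h
    · exact h ▸ le_top
    · have hpne : p.hom ≠ 0 := by
        rintro h0
        apply hq
        ext y
        rw [← hp, h0]
        rfl
      have : IsCoatom (LinearMap.ker p.hom) :=
        LinearMap.isCoatom_ker_of_surjective (LinearMap.surjective_of_ne_zero hpne)
      rcases this.le_iff.1 h with h' | h'
      · exact absurd h' hf.ker_ne_top
      · exact h'.le
  apply hq
  ext y
  rw [← hp]
  exact hker y.2

theorem IsProjectiveCover.ker_ne_bot {P S T : ModuleCat.{u} A} {f : P →ₗ[A] S}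
    (hf : IsProjectiveCover f) (h : Nontrivial (Abelian.Ext.{u} S T 1)) :
    LinearMap.ker f ≠ ⊥ := by
  intro hk
  have := hf.1
  have : Module.Projective A S :=
    Module.Projective.of_equiv (LinearEquiv.ofBijective f ⟨LinearMap.ker_eq_bot.1 hk, hf.2.1⟩)
  have : Projective S := (IsProjective.iff_projective S).1 this
  obtain ⟨x, hx⟩ := exists_ne (0 : Abelian.Ext.{u} S T 1)
  exact hx (x.eq_zero_of_projective)

end Covers

/-! ### Projectives along the oriented cycle -/

section Cycles

variable {A : Type u} [Ring A] {n : ℕ} [NeZero n] {S : Fin n → ModuleCat.{u} A}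

theorem IsCyclicOrdering.exists_ker_surjective [IsNoetherianRing A] (hS : IsCyclicOrdering A S)
    {i : Fin n} {P : ModuleCat.{u} A} {f : P →ₗ[A] S i} (hf : IsProjectiveCover f) :
    ∃ q : LinearMap.ker f →ₗ[A] S (i + 1), Function.Surjective q := by
  have := hS.simple
  have := hf.finite
  have hne := hf.ker_ne_bot ((hS.arrow_iff i (i + 1)).2 rfl)
  have : Nontrivial (LinearMap.ker f) := Submodule.nontrivial_iff_ne_bot.2 hne
  obtain ⟨K, hK, -⟩ := (eq_top_or_exists_le_coatom (⊥ : Submodule A (LinearMap.ker f))).resolve_left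
    bot_ne_top
  have : IsSimpleModule A (LinearMap.ker f ⧸ K) := isSimpleModule_iff_isCoatom.2 hK
  obtain ⟨j, ⟨e⟩⟩ := hS.complete (ModuleCat.of A (LinearMap.ker f ⧸ K)) this
  let q := e.toLinearEquiv.toLinearMap ∘ₗ K.mkQ
  have hq : Function.Surjective q := e.toLinearEquiv.surjective.comp K.mkQ_surjective
  have hq0 : q ≠ 0 := by
    have := IsSimpleModule.nontrivial A (S j)
    exact LinearMap.ne_zero_of_surjective hq
  obtain rfl := (hS.arrow_iff i j).1 (hf.nontrivial_ext hq0)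
  exact ⟨q, hq⟩

theorem IsCyclicOrdering.exists_range_eq_ker [IsArtinianRing A] (hS : IsCyclicOrdering A S)
    (hA : IsNakayama A) {i : Fin n} {P Q : ModuleCat.{u} A} {f : P →ₗ[A] S i}
    (hf : IsProjectiveCover f) {f' : Q →ₗ[A] S (i + 1)} (hf' : IsProjectiveCover f') :
    ∃ g : Q →ₗ[A] P, LinearMap.range g = LinearMap.ker f := by
  have := hS.simple
  have := hf.finite
  obtain ⟨q, hq⟩ := hS.exists_ker_surjective hf
  have := hf'.1
  obtain ⟨g, hg⟩ := Module.projective_lifting_property q f' hq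
  have hco : IsCoatom (LinearMap.ker q) := LinearMap.isCoatom_ker_of_surjective hq
  have htop : LinearMap.range g = ⊤ := by
    -- Otherwise `f' = q ∘ g` would vanish. Since submodules of `P` form a chain, `range g` then
    -- contains the maximal submodule `ker q` strictly.
    have hle : ¬ LinearMap.range g ≤ LinearMap.ker q := by
      intro h
      apply hf'.ker_ne_top
      rw [← hg, eq_top_iff]
      exact fun x _ => h ⟨x, rfl⟩
    have htot := (hA.isUniserial hf).le_total ((LinearMap.range g).map (LinearMap.ker f).subtype)
      ((LinearMap.ker q).map (LinearMap.ker f).subtype)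
    rw [Submodule.map_le_map_iff_of_injective (Submodule.injective_subtype _),
      Submodule.map_le_map_iff_of_injective (Submodule.injective_subtype _)] at htot
    have h := htot.resolve_left hle
    exact (hco.le_iff.1 h).resolve_right fun h' => hle h'.le
  refine ⟨(LinearMap.ker f).subtype ∘ₗ g, ?_⟩
  rw [LinearMap.range_comp, htop, Submodule.map_top, Submodule.range_subtype]

/-- The modules `P i` are projective and uniserial of length `c i`, and the radical of `P i` is
an epimorphic image of `P (i + 1)`. -/
structure IsUniserialCycle (A : Type u) [Ring A] {n : ℕ} [NeZero n] (c : Fin n → ℕ)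
    (P : Fin n → ModuleCat.{u} A) : Prop where
  projective : ∀ i, Module.Projective A (P i)
  finite : ∀ i, Module.Finite A (P i)
  uniserial : ∀ i, IsUniserial A (P i)
  length_eq : ∀ i, Module.length A (P i) = c i
  exists_hom : ∀ i, ∃ g : P (i + 1) →ₗ[A] P i, Module.length A (LinearMap.range g) + 1 = c i

theorem IsCyclicOrdering.isUniserialCycle [IsArtinianRing A] (hS : IsCyclicOrdering A S)
    (hA : IsNakayama A) {c : Fin n → ℕ} {P : Fin n → ModuleCat.{u} A} {f : ∀ i, P i →ₗ[A] S i}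
    (hf : ∀ i, IsProjectiveCover (f i)) (hc : ∀ i, Module.length A (P i) = c i) :
    IsUniserialCycle A c P := by
  have := hS.simple
  refine ⟨fun i => (hf i).1, fun i => (hf i).finite, fun i => hA.isUniserial (hf i), hc,
    fun i => ?_⟩
  obtain ⟨g, hg⟩ := hS.exists_range_eq_ker hA (hf i) (hf (i + 1))
  refine ⟨g, ?_⟩
  rw [hg, ← hc, length_ker_add (f i) (hf i).2.1, Module.length_eq_one A (S i)]

theorem IsCyclicOrdering.two_le [IsArtinianRing A] (hS : IsCyclicOrdering A S) {i : Fin n} {m : ℕ}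
    {P : ModuleCat.{u} A} {f : P →ₗ[A] S i} (hf : IsProjectiveCover f)
    (hc : Module.length A P = m) : 2 ≤ m := by
  have := hS.simple
  have hne := hf.ker_ne_bot ((hS.arrow_iff i (i + 1)).2 rfl)
  have : Nontrivial (LinearMap.ker f) := Submodule.nontrivial_iff_ne_bot.2 hne
  have h1 := Order.one_le_iff_pos.2 (Module.length_pos (R := A) (M := LinearMap.ker f))
  have h2 := length_ker_add f hf.2.1
  rw [Module.length_eq_one A (S i), hc] at h2
  have h3 : (1 : ℕ∞) + 1 ≤ m := h2 ▸ add_le_add_left h1 1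
  exact_mod_cast h3

theorem IsUniserialCycle.le_add_one {c : Fin n → ℕ} {P : Fin n → ModuleCat.{u} A}
    (h : IsUniserialCycle A c P) (i : Fin n) : c i ≤ c (i + 1) + 1 := by
  obtain ⟨g, hg⟩ := h.exists_hom i
  have h1 := Module.length_le_of_surjective _ g.surjective_rangeRestrict
  rw [h.length_eq] at h1
  have h2 : (c i : ℕ∞) ≤ c (i + 1) + 1 := hg ▸ add_le_add_left h1 1
  exact_mod_cast h2

/-- The `l`-th cyclic successor of `i`. -/
def shift (i : Fin n) (l : ℕ) : Fin n := Fin.ofNat n (i + l)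

theorem shift_zero (i : Fin n) : shift i 0 = i := by
  simp [shift]

theorem shift_succ (i : Fin n) (l : ℕ) : shift i (l + 1) = shift i l + 1 := by
  apply Fin.ext
  simp [shift, Fin.val_add, ← add_assoc]

/-- The image of `g` has colength one in a chain of submodules, so it contains every proper
submodule, in particular `ker h`. Restricting `h` to it thus costs exactly one unit of length. -/
theorem length_range_comp [IsArtinianRing A] {M N K : Type u} [AddCommGroup M] [Module A M]
    [AddCommGroup N] [Module A N] [AddCommGroup K] [Module A K] [Module.Finite A M]
    (hM : IsUniserial A M) (h : M →ₗ[A] N)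
    (g : K →ₗ[A] M) (hg : Module.length A (LinearMap.range g) + 1 = Module.length A M)
    (hh : h ≠ 0) :
    Module.length A (LinearMap.range (h ∘ₗ g)) + 1 = Module.length A (LinearMap.range h) := by
  have hle : LinearMap.ker h ≤ LinearMap.range g := by
    refine (hM.le_total _ _).elim id fun hgh => ?_
    by_contra hne
    have hlt := Submodule.height_strictMono (lt_of_le_not_ge hgh hne)
    rw [← Module.length_submodule, ← Module.length_submodule] at hlt
    have h1 := Order.add_one_le_of_lt hlt
    rw [hg] at h1
    refine hh (LinearMap.ker_eq_top.1 (eq_of_le_of_length_le le_top ?_))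
    rwa [Module.length_top]
  have e1 := length_ker_add_range h
  have e2 := length_ker_add_range (h ∘ₗ (LinearMap.range g).subtype)
  have e3 : LinearMap.range (h ∘ₗ (LinearMap.range g).subtype) = LinearMap.range (h ∘ₗ g) := by
    rw [LinearMap.range_comp, LinearMap.range_comp, Submodule.range_subtype]
  have e4 : Module.length A (LinearMap.ker (h ∘ₗ (LinearMap.range g).subtype)) =
      Module.length A (LinearMap.ker h) := by
    rw [LinearMap.ker_comp]
    exact (Submodule.comapSubtypeEquivOfLe hle).length_eq
  rw [e3, e4] at e2
  rw [← hg, e2, add_assoc] at e1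
  exact ENat.add_right_injective_of_ne_top
    (Module.length_ne_top (R := A) (M := LinearMap.ker h)) e1

theorem IsUniserialCycle.exists_hom_shift [IsArtinianRing A] {c : Fin n → ℕ}
    {P : Fin n → ModuleCat.{u} A} (hP : IsUniserialCycle A c P) (i : Fin n) (l : ℕ) (hl : l < c i) :
    ∃ h : P (shift i l) →ₗ[A] P i, Module.length A (LinearMap.range h) + l = c i := by
  induction l with
  | zero =>
    rw [shift_zero]
    refine ⟨LinearMap.id, ?_⟩
    rw [LinearMap.range_id, Module.length_top, hP.length_eq]
    simp
  | succ l ih =>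
    obtain ⟨h, hh⟩ := ih (by lia)
    rw [shift_succ]
    obtain ⟨g, hg⟩ := hP.exists_hom (shift i l)
    have := hP.finite
    refine ⟨h ∘ₗ g, ?_⟩
    rw [Nat.cast_add, Nat.cast_one, add_comm (l : ℕ∞) 1, ← add_assoc,
      length_range_comp (hP.uniserial _) h g (hg.trans (hP.length_eq _).symm), hh]
    rintro rfl
    rw [LinearMap.range_zero, Module.length_bot, zero_add] at hh
    exact absurd (by exact_mod_cast hh) (by lia : l ≠ c i)

end Cycles

end Nakayama

namespace Nakayama

/-! ### Syzygies of quotients of the uniserial projectives -/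

section Syzygies

/-- `M` is the quotient of length `l` of `P i`. -/
def IsQuotientOfLength {A : Type u} [Ring A] {n : ℕ} (P : Fin n → ModuleCat.{u} A) (i : Fin n) (l : ℕ) (M : ModuleCat.{u} A) :
    Prop :=
  ∃ π : P i →ₗ[A] M, Function.Surjective π ∧ Module.length A M = l

theorem IsQuotientOfLength.not_isZero {A : Type u} [Ring A] {n : ℕ} {P : Fin n → ModuleCat.{u} A} {i : Fin n} {l : ℕ} (h0 : 0 < l) {M : ModuleCat.{u} A}
    (hM : IsQuotientOfLength P i l M) : ¬ Limits.IsZero M := by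
  obtain ⟨-, -, hl⟩ := hM
  intro h
  have := ModuleCat.subsingleton_of_isZero h
  rw [Module.length_eq_zero] at hl
  norm_cast at hl
  lia

variable {A : Type u} [Ring A] {n : ℕ} [NeZero n] {c : Fin n → ℕ} {P : Fin n → ModuleCat.{u} A}

theorem IsUniserialCycle.exists_isQuotientOfLength [IsArtinianRing A]
    (hP : IsUniserialCycle A c P) {i : Fin n} {l : ℕ} (h0 : 0 < l) (hl : l ≤ c i) :
    ∃ M, IsQuotientOfLength P i l M := by
  have := hP.finite
  obtain ⟨h, hh⟩ : ∃ N : Submodule A (P i), Module.length A N + l = c i := by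
    rcases hl.lt_or_eq with hl | rfl
    · obtain ⟨h, hh⟩ := hP.exists_hom_shift i l hl
      exact ⟨_, hh⟩
    · exact ⟨⊥, by rw [Module.length_bot, zero_add]⟩
  refine ⟨ModuleCat.of A (P i ⧸ h), h.mkQ, h.mkQ_surjective, ?_⟩
  have e := length_ker_add h.mkQ h.mkQ_surjective
  rw [Submodule.ker_mkQ, hP.length_eq, ← hh] at e
  exact (ENat.add_right_injective_of_ne_top (Module.length_ne_top (R := A) (M := h)) e).symm

theorem IsUniserialCycle.projective_of_isQuotientOfLength [IsArtinianRing A]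
    (hP : IsUniserialCycle A c P) {i : Fin n} {M : ModuleCat.{u} A}
    (hM : IsQuotientOfLength P i (c i) M) : Projective M := by
  obtain ⟨π, hπ, hl⟩ := hM
  have := hP.finite
  have := hP.projective
  have e := length_ker_add π hπ
  rw [hP.length_eq, hl] at e
  have e' : Module.length A (LinearMap.ker π) = 0 :=
    ENat.add_left_injective_of_ne_top (ENat.natCast_ne_top (c i))
      (by simpa using e.symm)
  have hk : LinearMap.ker π = ⊥ := by
    rw [← Submodule.subsingleton_iff_eq_bot]
    exact Module.length_eq_zero_iff.1 e'
  have : Module.Projective A M :=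
    Module.Projective.of_equiv (LinearEquiv.ofBijective π ⟨LinearMap.ker_eq_bot.1 hk, hπ⟩)
  exact (IsProjective.iff_projective M).1 this

/-- The kernel of `P i → M` is the only submodule of length `c i - l`, so it is the image of `P
(shift i l)`. Dimension shifting starts at `k + 2`; nonprojectivity supplies the missing bottom
level. -/
theorem IsUniserialCycle.exists_syzygy [IsArtinianRing A]
    (hP : IsUniserialCycle A c P) {i : Fin n} {l : ℕ} (h0 : 0 < l) (hl : l < c i)
    {M : ModuleCat.{u} A} (hM : IsQuotientOfLength P i l M) :
    ¬ Projective M ∧ ∃ N, IsQuotientOfLength P (shift i l) (c i - l) N ∧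
      ∀ k, HasProjectiveDimensionLT M (k + 2) ↔ HasProjectiveDimensionLT N (k + 1) := by
  obtain ⟨π, hπ, hlM⟩ := hM
  have := hP.finite
  have := hP.projective
  have e := length_ker_add π hπ
  rw [hP.length_eq, hlM] at e
  have e' : Module.length A (LinearMap.ker π) = (c i - l : ℕ) := by
    apply ENat.add_left_injective_of_ne_top (ENat.natCast_ne_top l)
    simp only [← e]
    norm_cast
    lia
  refine ⟨fun hproj => ?_, ModuleCat.of A (LinearMap.ker π), ?_, fun k => ?_⟩
  · have : Module.Projective A M := (IsProjective.iff_projective M).2 hproj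
    obtain ⟨s, hs⟩ := Module.projective_lifting_property π LinearMap.id hπ
    have hs' (y : M) : π (s y) = y := LinearMap.congr_fun hs y
    -- A section has image meeting `ker π` trivially, so comparability makes one of them zero,
    -- against `0 < l < c i`.
    rcases (hP.uniserial i).le_total (LinearMap.range s) (LinearMap.ker π) with h | h
    · have : Subsingleton M := subsingleton_of_forall_eq 0 fun y =>
        (hs' y).symm.trans (h ⟨y, rfl⟩)
      rw [Module.length_eq_zero] at hlM
      norm_cast at hlM
      lia
    · have : LinearMap.ker π = ⊥ := by
        refine (Submodule.eq_bot_iff _).2 fun x hx => ?_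
        obtain ⟨y, rfl⟩ := h hx
        rw [LinearMap.mem_ker, hs'] at hx
        rw [hx, map_zero]
      rw [this, Module.length_bot] at e'
      norm_cast at e'
      lia
  · obtain ⟨h, hh⟩ := hP.exists_hom_shift i l hl
    have hr : LinearMap.range h = LinearMap.ker π := by
      apply (hP.uniserial i).eq_of_length_eq
      rw [e']
      apply ENat.add_left_injective_of_ne_top (ENat.natCast_ne_top l)
      simp only [hh]
      norm_cast
      lia
    refine ⟨h.codRestrict _ fun x => hr ▸ ⟨x, rfl⟩, fun ⟨y, hy⟩ => ?_, e'⟩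
    rw [← hr] at hy
    obtain ⟨x, rfl⟩ := hy
    exact ⟨x, rfl⟩
  · exact (LinearMap.shortExact_shortComplexKer hπ).hasProjectiveDimensionLT_X₃_iff k
      ((IsProjective.iff_projective (P i)).1 inferInstance)

/-- All quotients of length `l` of `P i` have projective dimension `k`. -/
def HasExactDimension (P : Fin n → ModuleCat.{u} A) (i : Fin n) (l k : ℕ) : Prop :=
  ∀ M, IsQuotientOfLength P i l M →
    HasProjectiveDimensionLT M (k + 1) ∧ ¬ HasProjectiveDimensionLT M k

theorem IsUniserialCycle.hasExactDimension_zero [IsArtinianRing A]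
    (hP : IsUniserialCycle A c P) {i : Fin n} {l : ℕ} (h0 : 0 < l) (hl : l = c i) :
    HasExactDimension P i l 0 := by
  subst hl
  intro M hM
  rw [zero_add, ← projective_iff_hasProjectiveDimensionLT_one,
    hasProjectiveDimensionLT_zero_iff_isZero]
  exact ⟨hP.projective_of_isQuotientOfLength hM, hM.not_isZero h0⟩

theorem IsUniserialCycle.hasExactDimension_succ [IsArtinianRing A]
    (hP : IsUniserialCycle A c P) {i : Fin n} {l k : ℕ} (h0 : 0 < l) (hl : l < c i)
    (h : HasExactDimension P (shift i l) (c i - l) k) :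
    HasExactDimension P i l (k + 1) := by
  intro M hM
  obtain ⟨hproj, N, hN, hk⟩ := hP.exists_syzygy h0 hl hM
  refine ⟨(hk k).2 (h N hN).1, ?_⟩
  cases k with
  | zero => rwa [zero_add, ← projective_iff_hasProjectiveDimensionLT_one]
  | succ k =>
    rw [hk k]
    exact (h N hN).2

/-- `X` is a set of nonprojective pairs closed under syzygy, so no iterated syzygy of a member
becomes projective. -/
theorem IsUniserialCycle.not_hasProjectiveDimensionLT [IsArtinianRing A]
    (hP : IsUniserialCycle A c P) (X : Fin n → ℕ → Prop)
    (hX : ∀ i l, X i l → 0 < l ∧ l < c i ∧ X (shift i l) (c i - l)) (k : ℕ) :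
    ∀ (i : Fin n) (l : ℕ) (_ : X i l) (M : ModuleCat.{u} A), IsQuotientOfLength P i l M →
      ¬ HasProjectiveDimensionLT M (k + 1) := by
  induction k with
  | zero =>
    intro i l hil M hM
    obtain ⟨h0, hl, -⟩ := hX i l hil
    rw [zero_add, ← projective_iff_hasProjectiveDimensionLT_one]
    exact (hP.exists_syzygy h0 hl hM).1
  | succ k ih =>
    intro i l hil M hM
    obtain ⟨h0, hl, hX'⟩ := hX i l hil
    obtain ⟨-, N, hN, hk⟩ := hP.exists_syzygy h0 hl hM
    rw [hk]
    exact ih _ _ hX' N hN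

theorem IsUniserialCycle.globalDimension_eq_top [IsArtinianRing A]
    (hP : IsUniserialCycle A c P) (X : Fin n → ℕ → Prop)
    (hX : ∀ i l, X i l → 0 < l ∧ l < c i ∧ X (shift i l) (c i - l))
    (hne : ∃ i l, X i l) : globalDimension A = ⊤ := by
  obtain ⟨i, l, hil⟩ := hne
  obtain ⟨M, hM⟩ := hP.exists_isQuotientOfLength (hX i l hil).1 (hX i l hil).2.1.le
  have hpd : projectiveDimension M = ⊤ := by
    by_contra h
    obtain ⟨k, hk⟩ := (projectiveDimension_ne_top_iff M).1 h
    exact hP.not_hasProjectiveDimensionLT X hX k i l hil M hM hk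
  have hfin : Module.Finite A M := by
    have := hP.finite i
    obtain ⟨π, hπ, -⟩ := hM
    exact Module.Finite.of_surjective π hπ
  exact top_le_iff.1 (hpd ▸ le_iSup₂ (f := fun (M : ModuleCat.{u} A) (_ : Module.Finite A M) =>
    projectiveDimension M) M hfin)

end Syzygies

/-! ### Global dimension from the simple modules -/

section GlobalDimension

variable {A : Type u} [Ring A]

theorem hasProjectiveDimensionLT_of_simple {k : ℕ}
    (h : ∀ T : ModuleCat.{u} A, IsSimpleModule A T → HasProjectiveDimensionLT T k)
    {M : Type u} [AddCommGroup M] [Module A M] (hM : IsFiniteLength A M) :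
    HasProjectiveDimensionLT (ModuleCat.of A M) k := by
  induction hM with
  | @of_subsingleton M =>
    have := (ModuleCat.isZero_of_subsingleton (ModuleCat.of A M)).hasProjectiveDimensionLT_zero
    exact hasProjectiveDimensionLT_of_ge _ 0 k (Nat.zero_le k)
  | @of_simple_quotient M _ _ N hs _ ih =>
    have hse : N.mkQ.shortComplexKer.ShortExact :=
      LinearMap.shortExact_shortComplexKer N.mkQ_surjective
    refine hse.hasProjectiveDimensionLT_X₂ k ?_ (h (ModuleCat.of A (M ⧸ N)) hs)
    exact hasProjectiveDimensionLT_of_iso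
      (LinearEquiv.ofEq N (LinearMap.ker N.mkQ) N.ker_mkQ.symm).toModuleIso k

theorem globalDimension_eq_of_simple [IsArtinianRing A] {k : ℕ}
    (h : ∀ T : ModuleCat.{u} A, IsSimpleModule A T → HasProjectiveDimensionLT T (k + 1))
    {S : ModuleCat.{u} A} (hS : IsSimpleModule A S) (hk : ¬ HasProjectiveDimensionLT S k) :
    globalDimension A = k := by
  apply le_antisymm
  · refine iSup₂_le fun M hM => (projectiveDimension_le_iff M k).2 ?_
    exact hasProjectiveDimensionLT_of_simple h
      (isFiniteLength_iff_isNoetherian_isArtinian.2 ⟨inferInstance, inferInstance⟩)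
  · refine ((projectiveDimension_ge_iff S k).2 hk).trans ?_
    exact le_iSup₂ (f := fun (M : ModuleCat.{u} A) (_ : Module.Finite A M) =>
      projectiveDimension M) S inferInstance

theorem IsCyclicOrdering.globalDimension_eq [IsArtinianRing A] {n : ℕ} [NeZero n]
    {S : Fin n → ModuleCat.{u} A} (hS : IsCyclicOrdering A S) {P : Fin n → ModuleCat.{u} A}
    {f : ∀ i, P i →ₗ[A] S i} (hf : ∀ i, Function.Surjective (f i)) {d : Fin n → ℕ} {k : ℕ}
    (hd : ∀ i, HasExactDimension P i 1 (d i)) (hle : ∀ i, d i ≤ k) (hk : ∃ i, d i = k) :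
    globalDimension A = k := by
  have hq (i : Fin n) : IsQuotientOfLength P i 1 (S i) := by
    have := hS.simple i
    exact ⟨f i, hf i, by rw [Module.length_eq_one]; rfl⟩
  obtain ⟨i, rfl⟩ := hk
  refine globalDimension_eq_of_simple (fun T hT => ?_) (hS.simple i) (hd i _ (hq i)).2
  obtain ⟨j, ⟨e⟩⟩ := hS.complete T hT
  have := (hd j _ (hq j)).1
  have := hasProjectiveDimensionLT_of_ge (S j) (d j + 1) (d i + 1) (Nat.succ_le_succ (hle j))
  exact hasProjectiveDimensionLT_of_iso e.symm _

end GlobalDimension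

end Nakayama

namespace Nakayama

/-! ### Three simples: normalization, periodic syzygies and explicit dimensions -/

section ThreeSimples

theorem exists_isNormalized_rotate {c : Fin 3 → ℕ} (h2 : ∀ i, 2 ≤ c i)
    (h : ∀ i, c i ≤ c (i + 1) + 1) : ∃ k, IsNormalized fun i => c (i + k) := by
  have a0 := h 0
  have a1 := h 1
  have a2 := h 2
  have b0 := h2 0
  have b1 := h2 1
  have b2 := h2 2
  simp only [Fin.isValue, zero_add, Fin.reduceAdd] at a0 a1 a2
  have hadm (k : Fin 3) : IsAdmissible fun i => c (i + k) := by
    refine ⟨fun j => by have := h2 (j + k); lia, fun j _ => h2 _, fun j => ?_⟩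
    have := h (j + k)
    rwa [add_right_comm] at this
  -- Unless `c` is constant, some minimal entry has a strictly larger cyclic predecessor, which
  -- exceeds it by exactly one. The rotation puts that minimal entry first.
  have hex : (c 0 = c 1 ∧ c 1 = c 2) ∨
      (c 0 ≤ c 1 ∧ c 0 ≤ c 2 ∧ c 2 = c 0 + 1) ∨
      (c 1 ≤ c 2 ∧ c 1 ≤ c 0 ∧ c 0 = c 1 + 1) ∨
      (c 2 ≤ c 0 ∧ c 2 ≤ c 1 ∧ c 1 = c 2 + 1) := by lia
  rcases hex with h | h | h | h
  · refine ⟨0, hadm 0, Or.inr (Or.inl ?_)⟩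
    simp [Fin.forall_fin_succ, h]
  · refine ⟨0, hadm 0, Or.inr (Or.inr ?_)⟩
    simpa [Fin.forall_fin_succ, Fin.rev, and_assoc] using h
  · refine ⟨1, hadm 1, Or.inr (Or.inr ?_)⟩
    simpa [Fin.forall_fin_succ, Fin.rev, and_assoc] using h
  · refine ⟨2, hadm 2, Or.inr (Or.inr ?_)⟩
    simpa [Fin.forall_fin_succ, Fin.rev, and_assoc] using h

theorem IsNormalized.cases {c : Fin 3 → ℕ} (hc : IsNormalized c) (h2 : ∀ i, 2 ≤ c i) :
    (c 0 = c 1 ∧ c 1 = c 2) ∨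
      (c 2 = c 0 + 1 ∧ (c 1 = c 0 ∨ c 1 = c 0 + 1 ∨ c 1 = c 0 + 2)) := by
  obtain ⟨⟨-, -, h⟩, hn⟩ := hc
  have a1 : c 1 ≤ c 2 + 1 := h 1
  have b2 := h2 2
  rcases hn with hn | hn | ⟨hn, hn'⟩
  · exact absurd (show c 2 = 1 from hn) (by lia)
  · exact Or.inl ⟨hn 0 1, hn 1 2⟩
  · have hn' : c 2 = c 0 + 1 := hn'
    have := hn 1
    lia

theorem IsNormalized.rotate_eq {c : Fin 3 → ℕ} {k : Fin 3} (hc : IsNormalized c)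
    (h2 : ∀ i, 2 ≤ c i) (hk : IsNormalized fun i => c (i + k)) : (fun i => c (i + k)) = c := by
  have h1 := hc.cases h2
  have h3 := hk.cases fun i => h2 (i + k)
  funext i
  fin_cases k <;> fin_cases i <;> simp at h3 ⊢ <;> lia

variable {A : Type u} [Ring A]

theorem IsCyclicOrdering.rotate {S : Fin 3 → ModuleCat.{u} A} (hS : IsCyclicOrdering A S)
    (k : Fin 3) : IsCyclicOrdering A fun i => S (i + k) where
  simple i := hS.simple _
  pairwise_nonisomorphic i j h := add_right_cancel (hS.pairwise_nonisomorphic _ _ h)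
  complete T hT := by
    obtain ⟨i, e⟩ := hS.complete T hT
    exact ⟨i - k, by rwa [sub_add_cancel]⟩
  arrow_iff i j := by
    rw [hS.arrow_iff, add_right_comm, add_left_inj]

/-- The top of the radical of the projective cover of a simple determines its successor in both
orderings, so matching one simple matches all. -/
theorem IsCyclicOrdering.exists_rotation [IsNoetherianRing A] {S S' : Fin 3 → ModuleCat.{u} A}
    (hS : IsCyclicOrdering A S) (hS' : IsCyclicOrdering A S') {P : Fin 3 → ModuleCat.{u} A}
    {f : ∀ i, P i →ₗ[A] S i} (hf : ∀ i, IsProjectiveCover (f i)) :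
    ∃ k, ∀ i, Nonempty (S' i ≅ S (i + k)) := by
  have step (i j : Fin 3) (h : Nonempty (S' i ≅ S j)) : Nonempty (S' (i + 1) ≅ S (j + 1)) := by
    obtain ⟨e⟩ := h
    obtain ⟨l, ⟨e'⟩⟩ := hS'.complete (S (j + 1)) (hS.simple _)
    have := hS'.simple
    have := hS.simple
    obtain ⟨q, hq⟩ := hS.exists_ker_surjective (hf j)
    have hcov := (hf j).comp_equiv e.symm.toLinearEquiv
    let r : LinearMap.ker (e.symm.toLinearEquiv.toLinearMap ∘ₗ f j) →ₗ[A] S' l :=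
      e'.toLinearEquiv.toLinearMap ∘ₗ q ∘ₗ
        (LinearEquiv.ofEq _ _ (LinearEquiv.ker_comp e.symm.toLinearEquiv (f j))).toLinearMap
    have hr : Function.Surjective r :=
      e'.toLinearEquiv.surjective.comp (hq.comp (LinearEquiv.surjective _))
    have hr0 : r ≠ 0 := by
      have := IsSimpleModule.nontrivial A (S' l)
      exact LinearMap.ne_zero_of_surjective hr
    obtain rfl := (hS'.arrow_iff i l).1 (hcov.nontrivial_ext hr0)
    exact ⟨e'.symm⟩
  obtain ⟨k, hk⟩ := hS.complete (S' 0) (hS'.simple 0)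
  have h1 := step 0 k hk
  have h2 := step _ _ h1
  refine ⟨k, fun i => ?_⟩
  fin_cases i
  · simpa using hk
  · simpa [add_comm] using h1
  · have e : (2 : Fin 3) + k = k + 1 + 1 := by rw [add_assoc, add_comm]; rfl
    show Nonempty (S' 2 ≅ S (2 + k))
    rw [e]
    exact h2

variable {c : Fin 3 → ℕ} {P : Fin 3 → ModuleCat.{u} A}

theorem IsUniserialCycle.globalDimension_eq_top_of_nat [IsArtinianRing A]
    (hP : IsUniserialCycle A c P) (X : ℕ → ℕ → Prop)
    (h0 : ∀ l, X 0 l → 0 < l ∧ l < c 0 ∧ X (l % 3) (c 0 - l))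
    (h1 : ∀ l, X 1 l → 0 < l ∧ l < c 1 ∧ X ((1 + l) % 3) (c 1 - l))
    (h2 : ∀ l, X 2 l → 0 < l ∧ l < c 2 ∧ X ((2 + l) % 3) (c 2 - l))
    (hne : ∃ i < 3, ∃ l, X i l) : globalDimension A = ⊤ := by
  refine hP.globalDimension_eq_top (fun i l => X i l) (fun i l hil => ?_) ?_
  · fin_cases i
    · simpa [shift] using h0 l hil
    · simpa [shift] using h1 l hil
    · simpa [shift] using h2 l hil
  · obtain ⟨i, hi, l, hl⟩ := hne
    exact ⟨⟨i, hi⟩, l, hl⟩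

theorem IsUniserialCycle.globalDimension_eq_top_of_normalized [IsArtinianRing A]
    (hP : IsUniserialCycle A c P) (h2 : ∀ i, 2 ≤ c i) (hc : IsNormalized c)
    (h : ¬ (c = ![2, 2, 3] ∨ c = ![2, 4, 3] ∨ c = ![3, 4, 4] ∨ c = ![3, 5, 4])) :
    globalDimension A = ⊤ := by
  have heq (a b d : ℕ) : c = ![a, b, d] ↔ c 0 = a ∧ c 1 = b ∧ c 2 = d := by
    rw [funext_iff]
    simp [Fin.forall_fin_succ]
  simp only [heq] at h
  have hm := h2 0
  have top := hP.globalDimension_eq_top_of_nat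
  rcases hc.cases h2 with hc | ⟨hc2, hc1 | hc1 | hc1⟩
  -- For constant `c` every nonprojective pair has a nonprojective syzygy.
  · refine top (fun _ l => 0 < l ∧ l < c 0) ?_ ?_ ?_ ⟨0, by lia, 1, by lia⟩ <;> intros <;> lia
  -- From here each `X` is a syzygy cycle of two or four pairs; for instance `(0, 1)` and `(1, c 0 -
  -- 1)` are exchanged when `c 1 = c 0` is divisible by 3. A pair `(i, 3)` keeps its vertex `i`, and
  -- the excluded sequences are those with `c i = 3` there.
  · obtain hr | hr | hr : c 0 % 3 = 0 ∨ c 0 % 3 = 1 ∨ c 0 % 3 = 2 := by lia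
    · refine top (fun i l => (i = 0 ∧ l = 1) ∨ (i = 1 ∧ l = c 0 - 1)) ?_ ?_ ?_
        ⟨0, by lia, 1, by lia⟩ <;> intros <;> lia
    · refine top (fun i l => (i = 1 ∧ l = 1) ∨ (i = 2 ∧ l = c 0 - 1) ∨ (i = 2 ∧ l = 2) ∨
        (i = 1 ∧ l = c 0 - 1)) ?_ ?_ ?_ ⟨1, by lia, 1, by lia⟩ <;> intros <;> lia
    · refine top (fun i l => (i = 2 ∧ l = 3) ∨ (i = 2 ∧ l = c 0 - 2)) ?_ ?_ ?_
        ⟨2, by lia, 3, by lia⟩ <;> intros <;> lia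
  · obtain hr | hr | hr : c 0 % 3 = 0 ∨ c 0 % 3 = 1 ∨ c 0 % 3 = 2 := by lia
    · refine top (fun i l => (i = 0 ∧ l = 3) ∨ (i = 0 ∧ l = c 0 - 3)) ?_ ?_ ?_
        ⟨0, by lia, 3, by lia⟩ <;> intros <;> lia
    · refine top (fun i l => (i = 0 ∧ l = 1) ∨ (i = 1 ∧ l = c 0 - 1) ∨ (i = 1 ∧ l = 2) ∨
        (i = 0 ∧ l = c 0 - 1)) ?_ ?_ ?_ ⟨0, by lia, 1, by lia⟩ <;> intros <;> lia
    · refine top (fun i l => (i = 1 ∧ l = 1) ∨ (i = 2 ∧ l = c 0)) ?_ ?_ ?_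
        ⟨1, by lia, 1, by lia⟩ <;> intros <;> lia
  · obtain hr | hr | hr : c 0 % 3 = 0 ∨ c 0 % 3 = 1 ∨ c 0 % 3 = 2 := by lia
    · refine top (fun i l => (i = 0 ∧ l = 3) ∨ (i = 0 ∧ l = c 0 - 3)) ?_ ?_ ?_
        ⟨0, by lia, 3, by lia⟩ <;> intros <;> lia
    · refine top (fun i l => (i = 1 ∧ l = 3) ∨ (i = 1 ∧ l = c 0 - 1)) ?_ ?_ ?_
        ⟨1, by lia, 3, by lia⟩ <;> intros <;> lia
    · refine top (fun i l => (i = 2 ∧ l = 3) ∨ (i = 2 ∧ l = c 0 - 2)) ?_ ?_ ?_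
        ⟨2, by lia, 3, by lia⟩ <;> intros <;> lia

variable {S : Fin 3 → ModuleCat.{u} A} {f : ∀ i, P i →ₗ[A] S i}

theorem IsCyclicOrdering.globalDimension_eq_of_three [IsArtinianRing A]
    (hS : IsCyclicOrdering A S) (hf : ∀ i, Function.Surjective (f i)) {d₀ d₁ d₂ k : ℕ}
    (h₀ : HasExactDimension P 0 1 d₀) (h₁ : HasExactDimension P 1 1 d₁)
    (h₂ : HasExactDimension P 2 1 d₂) (hk : d₀ = k ∧ d₁ ≤ k ∧ d₂ ≤ k) :
    globalDimension A = k := by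
  refine hS.globalDimension_eq hf (d := ![d₀, d₁, d₂]) (fun i => ?_) (fun i => ?_) ⟨0, hk.1⟩
  · fin_cases i
    exacts [h₀, h₁, h₂]
  · fin_cases i
    exacts [hk.1.le, hk.2.1, hk.2.2]

/-- The syzygy orbit `(0,1) → (1,1) → (2,1) → (0,2)` ends in a projective and passes through all the
simples; it is computed from its end. -/
theorem IsCyclicOrdering.globalDimension_of_two_two_three [IsArtinianRing A]
    (hS : IsCyclicOrdering A S) (hf : ∀ i, Function.Surjective (f i))
    (hP : IsUniserialCycle A ![2, 2, 3] P) : globalDimension A = 3 := by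
  have a : HasExactDimension P 0 2 0 := hP.hasExactDimension_zero (by decide) (by decide)
  have b : HasExactDimension P 2 1 1 := hP.hasExactDimension_succ (by decide) (by decide) a
  have c : HasExactDimension P 1 1 2 := hP.hasExactDimension_succ (by decide) (by decide) b
  have d : HasExactDimension P 0 1 3 := hP.hasExactDimension_succ (by decide) (by decide) c
  exact hS.globalDimension_eq_of_three hf d c b (by decide)

theorem IsCyclicOrdering.globalDimension_of_two_four_three [IsArtinianRing A]
    (hS : IsCyclicOrdering A S) (hf : ∀ i, Function.Surjective (f i))
    (hP : IsUniserialCycle A ![2, 4, 3] P) : globalDimension A = 2 := by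
  have a : HasExactDimension P 2 3 0 := hP.hasExactDimension_zero (by decide) (by decide)
  have b : HasExactDimension P 1 1 1 := hP.hasExactDimension_succ (by decide) (by decide) a
  have c : HasExactDimension P 0 1 2 := hP.hasExactDimension_succ (by decide) (by decide) b
  have d : HasExactDimension P 0 2 0 := hP.hasExactDimension_zero (by decide) (by decide)
  have e : HasExactDimension P 2 1 1 := hP.hasExactDimension_succ (by decide) (by decide) d
  exact hS.globalDimension_eq_of_three hf c b e (by decide)

/-- The longest orbit is `(0,1) → (1,2) → (0,2) → (2,1) → (0,3)`; that of `(1,1)` joins it at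
`(2,1)` after passing `(2,3)`. -/
theorem IsCyclicOrdering.globalDimension_of_three_four_four [IsArtinianRing A]
    (hS : IsCyclicOrdering A S) (hf : ∀ i, Function.Surjective (f i))
    (hP : IsUniserialCycle A ![3, 4, 4] P) : globalDimension A = 4 := by
  have a : HasExactDimension P 0 3 0 := hP.hasExactDimension_zero (by decide) (by decide)
  have b : HasExactDimension P 2 1 1 := hP.hasExactDimension_succ (by decide) (by decide) a
  have c : HasExactDimension P 0 2 2 := hP.hasExactDimension_succ (by decide) (by decide) b
  have d : HasExactDimension P 1 2 3 := hP.hasExactDimension_succ (by decide) (by decide) c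
  have e : HasExactDimension P 0 1 4 := hP.hasExactDimension_succ (by decide) (by decide) d
  have g : HasExactDimension P 2 3 2 := hP.hasExactDimension_succ (by decide) (by decide) b
  have h : HasExactDimension P 1 1 3 := hP.hasExactDimension_succ (by decide) (by decide) g
  exact hS.globalDimension_eq_of_three hf e h b (by decide)

theorem IsCyclicOrdering.globalDimension_of_three_five_four [IsArtinianRing A]
    (hS : IsCyclicOrdering A S) (hf : ∀ i, Function.Surjective (f i))
    (hP : IsUniserialCycle A ![3, 5, 4] P) : globalDimension A = 2 := by
  have a : HasExactDimension P 0 3 0 := hP.hasExactDimension_zero (by decide) (by decide)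
  have b : HasExactDimension P 1 2 1 := hP.hasExactDimension_succ (by decide) (by decide) a
  have c : HasExactDimension P 0 1 2 := hP.hasExactDimension_succ (by decide) (by decide) b
  have d : HasExactDimension P 2 4 0 := hP.hasExactDimension_zero (by decide) (by decide)
  have e : HasExactDimension P 1 1 1 := hP.hasExactDimension_succ (by decide) (by decide) d
  have g : HasExactDimension P 2 1 1 := hP.hasExactDimension_succ (by decide) (by decide) a
  exact hS.globalDimension_eq_of_three hf c e g (by decide)

end ThreeSimples

/-! ### Existence and uniqueness of the normalized sequence -/

section Sequences

variable {A : Type u} [Ring A] [IsArtinianRing A]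

theorem IsCycleAlgebra.exists_isNormalizedSequenceOf (hA : IsCycleAlgebra A 3) :
    ∃ c : Fin 3 → ℕ, IsNormalizedSequenceOf A c := by
  obtain ⟨-, hN, S, hS⟩ := hA
  have := hS.simple
  choose P f hf using fun i => exists_isProjectiveCover (A := A) (S := S i)
  have hfin := fun i => (hf i).finite
  choose c hc using fun i => ENat.ne_top_iff_exists.1 (Module.length_ne_top (R := A) (M := P i))
  have hP := hS.isUniserialCycle hN hf fun i => (hc i).symm
  obtain ⟨k, hk⟩ := exists_isNormalized_rotate (fun i => hS.two_le (hf i) (hc i).symm)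
    hP.le_add_one
  exact ⟨_, hk, _, hS.rotate k, fun j => ⟨P (j + k), f (j + k), hf _, (hc _).symm⟩⟩

/-- Cyclic orderings differ by a rotation and isomorphic simples have covers of equal length, so the
two sequences are rotations of each other; normalization leaves only one. -/
theorem IsNormalizedSequenceOf.unique {c c' : Fin 3 → ℕ} (hc : IsNormalizedSequenceOf A c)
    (hc' : IsNormalizedSequenceOf A c') : c' = c := by
  obtain ⟨hn, S, hS, hc⟩ := hc
  obtain ⟨hn', S', hS', hc'⟩ := hc'
  choose P f hf hl using hc
  choose P' f' hf' hl' using hc'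
  obtain ⟨k, hk⟩ := hS.exists_rotation hS' hf
  have h : c' = fun i => c (i + k) := by
    funext i
    obtain ⟨e⟩ := hk i
    have := ((hf' i).comp_equiv e.toLinearEquiv).length_eq (hf (i + k))
    rw [hl, hl'] at this
    exact_mod_cast this
  subst h
  exact hn.rotate_eq (fun i => hS.two_le (hf i) (hl i)) hn'

end Sequences

end Nakayama

theorem mainTheorem11 {R : Type v} {A : Type u} [CommRing R] [IsArtinianRing R] [Ring A]
    [Algebra R A] [Module.Finite R A] (hA : Nakayama.IsCycleAlgebra A 3)
    (hinj : ¬ Module.Injective A A) :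
    (∃! c : Fin 3 → ℕ, Nakayama.IsNormalizedSequenceOf A c) ∧
    ∀ c : Fin 3 → ℕ, Nakayama.IsNormalizedSequenceOf A c →
      (Nakayama.globalDimension A < ⊤ ↔
        c = ![2, 2, 3] ∨ c = ![2, 4, 3] ∨ c = ![3, 4, 4] ∨ c = ![3, 5, 4]) ∧
      (c = ![2, 2, 3] → Nakayama.globalDimension A = 3) ∧
      (c = ![2, 4, 3] → Nakayama.globalDimension A = 2) ∧
      (c = ![3, 4, 4] → Nakayama.globalDimension A = 4) ∧
      (c = ![3, 5, 4] → Nakayama.globalDimension A = 2) := by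
  have : IsArtinianRing A := IsArtinianRing.of_finite R A
  obtain ⟨c₀, hc₀⟩ := hA.exists_isNormalizedSequenceOf
  refine ⟨⟨c₀, hc₀, fun c hc => hc₀.unique hc⟩, fun c hc => ?_⟩
  obtain ⟨hn, S, hS, hc⟩ := hc
  choose P f hf hl using hc
  have hs := fun i => (hf i).2.1
  have hP := hS.isUniserialCycle hA.2.1 hf hl
  have h₁ : c = ![2, 2, 3] → Nakayama.globalDimension A = 3 := by
    rintro rfl
    exact hS.globalDimension_of_two_two_three hs hP
  have h₂ : c = ![2, 4, 3] → Nakayama.globalDimension A = 2 := by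
    rintro rfl
    exact hS.globalDimension_of_two_four_three hs hP
  have h₃ : c = ![3, 4, 4] → Nakayama.globalDimension A = 4 := by
    rintro rfl
    exact hS.globalDimension_of_three_four_four hs hP
  have h₄ : c = ![3, 5, 4] → Nakayama.globalDimension A = 2 := by
    rintro rfl
    exact hS.globalDimension_of_three_five_four hs hP
  have lt (k : ℕ) : (k : WithBot ℕ∞) < ⊤ :=
    WithBot.coe_lt_coe.2 (ENat.natCast_lt_top k)
  refine ⟨⟨fun hlt => ?_, ?_⟩, h₁, h₂, h₃, h₄⟩
  · by_contra h
    exact hlt.ne (hP.globalDimension_eq_top_of_normalized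
      (fun i => hS.two_le (hf i) (hl i)) hn h)
  · rintro (h | h | h | h)
    · exact h₁ h ▸ lt 3
    · exact h₂ h ▸ lt 2
    · exact h₃ h ▸ lt 4
    · exact h₄ h ▸ lt 2
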